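/- Let $\mathbb D\in\{\mathbb R,\mathbb C,\mathbb H\}$ and let $H$ be a Hilbert space over $\mathbb D$, not necessarily separable. For $\mathbb D=\mathbb H$ the scalars act on the right, and the scalar product $\langle\cdot|\cdot\rangle$ takes values in $\mathbb H$, is right-linear in the second entry, Hermitian and positive definite. Let $\mathfrak B(H)$ be the set of bounded $\mathbb D$-linear operators on $H$. For $T\in\mathfrak B(H)$ let $|T|$ be the unique self-adjoint positive operator in $\mathfrak B(H)$ with $|T|^2=T^*T$, and call $T$ trace class, $T\in\mathfrak B_1(H)$, if $\sum_{u\in N}\langle u|\,|T|u\rangle<\infty$ for some Hilbert basis $N$ of $H$. For $T\in\mathfrak B_1(H)$ the real trace is $\mathrm{tr}^{\mathbb R}(T):=\mathrm{Re}\sum_{u\in N}\langle u|Tu\rangle$, where $N$ is any Hilbert basis, $\mathrm{Re}\,q=\tfrac12(q+\overline q)$, and the series converges unconditionally; the value does not depend on $N$. Let $A\in\mathfrak B_1(H)$ and $B\in\mathfrak B(H)$, or vice versa. Let $U:H\to H$ be unitary (surjective, norm-preserving and $\mathbb D$-linear) or, if $\mathbb D=\mathbb C$, unitary or anti-unitary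 (surjective, norm-preserving and conjugate-linear). Then $A\,UBU^{-1}$ and $U^{-1}AU\,B$ are trace-class operators, their real traces are well defined, and $$\mathrm{tr}^{\mathbb R}\big(A\;UBU^{-1}\big)=\mathrm{tr}^{\mathbb R}\big(U^{-1}AU\;B\big).$$ In particular, this holds if $A=P$ is an orthogonal projector ($P\in\mathfrak B(H)$, $PP=P=P^*$) and $B=T$ is a state, that is, a self-adjoint positive operator $T\in\mathfrak B_1(H)$ with unit trace. -/

import Mathlib

open scoped Quaternion
open MulOpposite

/-- A quaternionic inner product space: scalars act on the right (so `op q • x` is `x q`), and the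
`ℍ`-valued scalar product is additive and right-`ℍ`-linear in the right entry, Hermitian, positive
definite (through the norm axiom) and induces the norm, `⟨x|x⟩ = ‖x‖²`.  A quaternionic Hilbert
space is such a space that is moreover complete (`CompleteSpace H`). -/
class QuaternionicInnerProductSpace (H : Type*) [NormedAddCommGroup H] extends
    Module ℍᵐᵒᵖ H, Inner ℍ H where
  inner_self_eq_norm_sq : ∀ x : H, inner x x = ((‖x‖ ^ 2 : ℝ) : ℍ)
  star_inner : ∀ x y : H, star (inner y x) = inner x y
  inner_add_right : ∀ x y z : H, inner x (y + z) = inner x y + inner x z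
  inner_smul_right : ∀ (x y : H) (q : ℍ), inner x (op q • y) = inner x y * q

/-! The following notions are common to the three kinds of Hilbert spaces.  `D` is the set of
scalars in which the scalar product takes its values; `R` is the ring whose module structure
expresses linearity: `R = D` if `D` is `ℝ` or `ℂ`, and `R = ℍᵐᵒᵖ` (right scalars) if `D = ℍ`.
Bounded operators are the continuous `R`-linear maps `H →L[R] H`. -/

section HilbertOperators

variable (D : Type*) {R H : Type*} [NormedRing D] [NormedAlgebra ℝ D] [StarRing D]
  [Semiring R] [NormedAddCommGroup H] [Module R H] [Inner D H]

/-- `N` is a Hilbert basis: an orthonormal set whose orthogonal complement is `{0}`. -/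
structure IsHilbertBasis (N : Set H) : Prop where
  norm_one : ∀ u ∈ N, inner D u u = 1
  orthogonal : ∀ u ∈ N, ∀ v ∈ N, u ≠ v → inner D u v = 0
  complete : ∀ x : H, (∀ u ∈ N, inner D u x = 0) → x = 0

/-- `T'` is the adjoint of `T`. -/
def IsAdjointOf (T' T : H →L[R] H) : Prop :=
  ∀ x y : H, inner D (T' x) y = inner D x (T y)

/-- `T = T*`. -/
def IsSelfAdjointOp (T : H →L[R] H) : Prop :=
  IsAdjointOf D T T

/-- `⟨x|Tx⟩` is a non-negative real number for every `x`. -/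
def IsPositiveOp (T : H →L[R] H) : Prop :=
  ∀ x : H, ∃ r : ℝ, 0 ≤ r ∧ inner D x (T x) = algebraMap ℝ D r

/-- `S = |T|`, that is, `S` is the (unique) self-adjoint positive bounded operator
with `S S = T* T`. -/
def IsOperatorAbs (S T : H →L[R] H) : Prop :=
  IsSelfAdjointOp D S ∧ IsPositiveOp D S ∧
    ∃ T' : H →L[R] H, IsAdjointOf D T' T ∧ S * S = T' * T

/-- `T` is of trace class: `∑_{u ∈ N} ⟨u| |T| u⟩ < ∞` for some Hilbert basis `N`. -/
def IsTraceClass (T : H →L[R] H) : Prop :=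
  ∃ S : H →L[R] H, IsOperatorAbs D S T ∧
    ∃ N : Set H, IsHilbertBasis D N ∧
      Summable fun u : N => inner D (u : H) (S (u : H))

/-- The `N`-trace of `T` converges (unconditionally) to `s`:
`tr_N(T) = ∑_{u ∈ N} ⟨u|Tu⟩ = s`. -/
def HasTraceOn (N : Set H) (T : H →L[R] H) (s : D) : Prop :=
  HasSum (fun u : N => inner D (u : H) (T (u : H))) s

/-- `tr^ℝ(T)` is well defined and equal to `r`: `T` is of trace class, and for every Hilbert
basis `N` the `N`-trace of `T` converges and has real part `r`, where
`Re q = (q + q̄) / 2`. -/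
def HasRealTrace (T : H →L[R] H) (r : ℝ) : Prop :=
  IsTraceClass D T ∧
    ∀ N : Set H, IsHilbertBasis D N →
      ∃ s : D, HasTraceOn D N T s ∧ (2⁻¹ : ℝ) • (s + star s) = algebraMap ℝ D r

/-- The orthogonal projectors `P P = P = P*`. -/
def IsOrthogonalProjector (P : H →L[R] H) : Prop :=
  P * P = P ∧ IsSelfAdjointOp D P

/-- The quantum states: self-adjoint positive trace-class operators with unit trace. -/
def IsQuantumState (T : H →L[R] H) : Prop :=
  IsSelfAdjointOp D T ∧ IsPositiveOp D T ∧ IsTraceClass D T ∧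
    ∀ N : Set H, IsHilbertBasis D N → HasTraceOn D N T 1

end HilbertOperators

/-- `U B U⁻¹` for a surjective norm-preserving map `U` that is linear (`σ = id`, a unitary
operator) or conjugate-linear (`R = ℂ` and `σ` the conjugation, an anti-unitary operator). -/
noncomputable def conjOp {R H : Type*} [Semiring R] [NormedAddCommGroup H] [Module R H]
    {σ σ' : R →+* R} [RingHomInvPair σ σ'] [RingHomInvPair σ' σ]
    (U : H ≃ₛₗᵢ[σ] H) (B : H →L[R] H) : H →L[R] H :=
  (U.toContinuousLinearEquiv : H →SL[σ] H).comp
    (B.comp (U.symm.toContinuousLinearEquiv : H →SL[σ'] H))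

/-! Forget the scalars: with the scalar product `Re ⟨x|y⟩`, `H` is a real Hilbert space, and `U` is
real orthogonal whether it is linear or conjugate-linear. A Hilbert basis `N` over `D` becomes the
real basis of all `u e`, with `u` in `N` and `e` a unit of `D`. Each `u e` contributes `Re ⟨u|Tu⟩`,
so the real trace is the trace over `ℝ` divided by `dim D`.

Over `ℝ` the claim is basis independence: the trace of `A V B V⁻¹` in the basis `V b` is the trace
of `V⁻¹ A V B` in `b`. Products of two Hilbert–Schmidt operators form a two-sided ideal on which
polarization makes the trace basis independent (`IsNuclear.exists_hasSum`).

Trace class over `D` matches this notion over `ℝ` through `T = W|T|` and `|T| = W'T`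
(`exists_mul_eq_of_norm_apply_le`) and `|T| = √|T| √|T|`. The real modulus is again `D`-linear
because square roots inherit commutation (`exists_sqrt`). -/

section RealHilbert

open ContinuousLinearMap Filter Topology
open scoped InnerProductSpace InnerProduct

/-! ### The Riesz–Nagy iteration in a Banach algebra -/

/-- The Riesz–Nagy iteration `Y ↦ (X + Y²) / 2`, started at `0`. -/
noncomputable def rieszNagyIterate {A : Type*} [Ring A] [Module ℝ A] (X : A) : ℕ → A
  | 0 => 0
  | n + 1 => (2⁻¹ : ℝ) • (X + rieszNagyIterate X n * rieszNagyIterate X n)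

theorem rieszNagyIterate_one_nonneg (n : ℕ) : 0 ≤ rieszNagyIterate (1 : ℝ) n := by
  cases n with
  | zero => simp [rieszNagyIterate]
  | succ n =>
    simp only [rieszNagyIterate, smul_eq_mul]
    nlinarith [mul_self_nonneg (rieszNagyIterate (1 : ℝ) n)]

theorem rieszNagyIterate_one_le_one (n : ℕ) : rieszNagyIterate (1 : ℝ) n ≤ 1 := by
  induction n with
  | zero => simp [rieszNagyIterate]
  | succ n ih =>
    have := rieszNagyIterate_one_nonneg n
    simp only [rieszNagyIterate, smul_eq_mul]
    nlinarith

section Banach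

variable {A : Type*} [NormedRing A] [NormedAlgebra ℝ A]

theorem norm_rieszNagyIterate_le {X : A} (hX : ‖X‖ ≤ 1) (n : ℕ) :
    ‖rieszNagyIterate X n‖ ≤ rieszNagyIterate (1 : ℝ) n := by
  induction n with
  | zero => simp [rieszNagyIterate]
  | succ n ih =>
    simp only [rieszNagyIterate, smul_eq_mul, norm_smul, norm_inv, Real.norm_ofNat]
    gcongr
    refine (norm_add_le _ _).trans (add_le_add hX ((norm_mul_le _ _).trans ?_))
    gcongr
    exact rieszNagyIterate_one_nonneg n

/-- The scalar iteration at `X = 1` is a majorant: `Y² - Z² = Y(Y - Z) + (Y - Z)Z` holds without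
commutativity, so the scalar increments bound the operator ones. They telescope and stay below the
fixed point `1`, which gives convergence. -/
theorem norm_rieszNagyIterate_succ_sub_le {X : A} (hX : ‖X‖ ≤ 1) (n : ℕ) :
    ‖rieszNagyIterate X (n + 1) - rieszNagyIterate X n‖ ≤
      rieszNagyIterate (1 : ℝ) (n + 1) - rieszNagyIterate (1 : ℝ) n := by
  induction n with
  | zero =>
    simp only [rieszNagyIterate, smul_eq_mul, norm_smul, norm_inv, Real.norm_ofNat, mul_zero,
      add_zero, sub_zero]
    gcongr
  | succ n ih =>
    set Y := rieszNagyIterate X (n + 1) with hY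
    set Z := rieszNagyIterate X n with hZ
    set y := rieszNagyIterate (1 : ℝ) (n + 1) with hy
    set z := rieszNagyIterate (1 : ℝ) n with hz
    have hYn : ‖Y‖ ≤ y := norm_rieszNagyIterate_le hX _
    have hZn : ‖Z‖ ≤ z := norm_rieszNagyIterate_le hX _
    have e1 : rieszNagyIterate X (n + 1 + 1) - Y = (2⁻¹ : ℝ) • (Y * (Y - Z) + (Y - Z) * Z) := by
      have h1 : rieszNagyIterate X (n + 1 + 1) = (2⁻¹ : ℝ) • (X + Y * Y) := rfl
      have h2 : Y = (2⁻¹ : ℝ) • (X + Z * Z) := rfl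
      rw [h1]
      nth_rewrite 3 [h2]
      rw [← smul_sub]
      congr 1
      noncomm_ring
    have e2 : rieszNagyIterate (1 : ℝ) (n + 1 + 1) - y = 2⁻¹ * (y * (y - z) + (y - z) * z) := by
      have h1 : rieszNagyIterate (1 : ℝ) (n + 1 + 1) = 2⁻¹ * (1 + y * y) := rfl
      have h2 : y = 2⁻¹ * (1 + z * z) := rfl
      rw [h1]
      linear_combination -h2
    rw [e1, e2, norm_smul, norm_inv, Real.norm_ofNat]
    have hyz : 0 ≤ y - z := (norm_nonneg _).trans ih
    gcongr
    refine (norm_add_le _ _).trans (add_le_add ?_ ?_) <;> refine (norm_mul_le _ _).trans ?_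
    · exact mul_le_mul hYn ih (norm_nonneg _) (rieszNagyIterate_one_nonneg _)
    · exact mul_le_mul ih hZn (norm_nonneg _) hyz

theorem exists_tendsto_rieszNagyIterate [CompleteSpace A] {X : A} (hX : ‖X‖ ≤ 1) :
    ∃ Y, Tendsto (rieszNagyIterate X) atTop (𝓝 Y) := by
  refine cauchySeq_tendsto_of_complete (cauchySeq_of_dist_le_of_summable
    (fun n => rieszNagyIterate (1 : ℝ) (n + 1) - rieszNagyIterate (1 : ℝ) n)
    (fun n => ?_) ?_)
  · rw [dist_comm, dist_eq_norm]
    exact norm_rieszNagyIterate_succ_sub_le hX n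
  · refine summable_of_sum_range_le (c := 1)
      (fun n => (norm_nonneg _).trans (norm_rieszNagyIterate_succ_sub_le (X := X) hX n)) ?_
    intro n
    rw [Finset.sum_range_sub]
    simpa [rieszNagyIterate] using rieszNagyIterate_one_le_one n

end Banach

/-! ### Operators on a real Hilbert space: square roots and factorization -/

variable {H : Type*} [NormedAddCommGroup H] [InnerProductSpace ℝ H]

theorem mul_apply_eq (A B : H →L[ℝ] H) (x : H) : (A * B) x = A (B x) := rfl

theorem one_apply_eq (x : H) : (1 : H →L[ℝ] H) x = x := rfl

/-- Hilbert–Schmidt operators. -/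
def IsHilbertSchmidt (X : H →L[ℝ] H) : Prop :=
  ∃ (w : Set H) (b : HilbertBasis w ℝ H), Summable fun i => ‖X (b i)‖ ^ 2

theorem IsHilbertSchmidt.mul_left {X : H →L[ℝ] H} (hX : IsHilbertSchmidt X) (A : H →L[ℝ] H) : IsHilbertSchmidt (A * X) := by
  obtain ⟨w, b, h⟩ := hX
  refine ⟨w, b, (h.mul_left (‖A‖ ^ 2)).of_nonneg_of_le (fun i => sq_nonneg _) fun i => ?_⟩
  rw [← mul_pow]
  exact pow_le_pow_left₀ (norm_nonneg _) (A.le_opNorm (X (b i))) 2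

variable [CompleteSpace H]

/-- Iterate at `X = 1 - T`. The limit satisfies `2Y = X + Y²`, that is, `(1 - Y)² = T`.
Self-adjointness and commutation pass to the limit, and `‖Y‖ ≤ 1` makes `1 - Y` positive. -/
theorem exists_sqrt_of_norm_le_one {T : H →L[ℝ] H} (hT : T† = T) (hpos : ∀ x, 0 ≤ ⟪x, T x⟫_ℝ)
    (hn : ‖T‖ ≤ 1) :
    ∃ S : H →L[ℝ] H, S† = S ∧ (∀ x, 0 ≤ ⟪x, S x⟫_ℝ) ∧ S * S = T ∧
      ∀ Z : H →L[ℝ] H, Commute Z T → Commute Z S := by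
  have hX : ‖1 - T‖ ≤ 1 := by
    refine opNorm_le_bound _ zero_le_one fun x => ?_
    -- Together with `‖T‖ ≤ 1`, positivity at `x - Tx` yields `‖Tx‖² ≤ ⟪x, Tx⟫`, whence `‖x - Tx‖² ≤
    -- ‖x‖² - ⟪x, Tx⟫ ≤ ‖x‖²`.
    have h1 := hpos (x - T x)
    have h2 : ⟪x, T (T x)⟫_ℝ = ⟪T x, T x⟫_ℝ := by
      rw [← adjoint_inner_left, hT]
    have h3 : ⟪T x, T (T x)⟫_ℝ ≤ ⟪T x, T x⟫_ℝ := by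
      refine (real_inner_le_norm _ _).trans ?_
      rw [real_inner_self_eq_norm_mul_norm]
      gcongr
      exact (le_opNorm _ _).trans (mul_le_of_le_one_left (norm_nonneg _) hn)
    simp only [map_sub, inner_sub_left, inner_sub_right, h2] at h1
    rw [one_mul]
    refine le_of_sq_le_sq ?_ (norm_nonneg _)
    rw [_root_.sub_apply, one_apply_eq, norm_sub_sq_real, ← real_inner_self_eq_norm_sq (T x)]
    linarith [hpos x]
  obtain ⟨Y, hY⟩ := exists_tendsto_rieszNagyIterate hX
  have hYn : ‖Y‖ ≤ 1 := le_of_tendsto hY.norm (.of_forall fun n =>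
    (norm_rieszNagyIterate_le hX n).trans (rieszNagyIterate_one_le_one n))
  have hfix : Y = (2⁻¹ : ℝ) • ((1 - T) + Y * Y) := by
    refine tendsto_nhds_unique (hY.comp (tendsto_add_atTop_nat 1)) ?_
    exact ((tendsto_const_nhds.add (hY.mul hY)).const_smul (2⁻¹ : ℝ))
  have hXs : star (1 - T) = 1 - T := by
    rw [star_sub, star_one, star_eq_adjoint, hT]
  have hYs : star Y = Y := by
    refine tendsto_nhds_unique hY.star (hY.congr fun n => ?_)
    induction n with
    | zero => simp [rieszNagyIterate]
    | succ n ih => simp only [rieszNagyIterate, star_smul, star_add, star_mul, hXs, ← ih]; simp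
  refine ⟨1 - Y, ?_, fun x => ?_, ?_, fun Z hZ => ?_⟩
  · rw [← star_eq_adjoint, star_sub, hYs, star_one]
  · have : ⟪x, Y x⟫_ℝ ≤ ⟪x, x⟫_ℝ := by
      refine (real_inner_le_norm _ _).trans ?_
      rw [real_inner_self_eq_norm_mul_norm]
      gcongr
      exact (le_opNorm _ _).trans (mul_le_of_le_one_left (norm_nonneg _) hYn)
    simp only [_root_.sub_apply, one_apply_eq, inner_sub_right]
    linarith
  · have h2 : (2 : ℝ) • Y = (1 - T) + Y * Y := by
      nth_rewrite 1 [hfix]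
      simp
    have h3 : (1 - Y) * (1 - Y) = 1 - (2 : ℝ) • Y + Y * Y := by
      rw [two_smul]; noncomm_ring
    rw [h3, h2]; abel
  · refine (Commute.one_right Z).sub_right ?_
    have hn : ∀ n, Commute Z (rieszNagyIterate (1 - T) n) := by
      intro n
      induction n with
      | zero => exact Commute.zero_right Z
      | succ n ih =>
        exact ((((Commute.one_right Z).sub_right hZ).add_right (ih.mul_right ih))).smul_right _
    exact tendsto_nhds_unique (hY.const_mul Z) ((hY.mul_const Z).congr fun n => (hn n).eq.symm)

/-- Positive operators on a real Hilbert space have a positive square root, which commutes with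
everything that commutes with the operator. -/
theorem exists_sqrt {T : H →L[ℝ] H} (hT : T† = T) (hpos : ∀ x, 0 ≤ ⟪x, T x⟫_ℝ) :
    ∃ S : H →L[ℝ] H, S† = S ∧ (∀ x, 0 ≤ ⟪x, S x⟫_ℝ) ∧ S * S = T ∧
      ∀ Z : H →L[ℝ] H, Commute Z T → Commute Z S := by
  set c : ℝ := ‖T‖ + 1
  have hc : 0 < c := by positivity
  obtain ⟨S, h1, h2, h3, h4⟩ := exists_sqrt_of_norm_le_one (T := c⁻¹ • T)
    (by rw [← star_eq_adjoint, star_smul, star_eq_adjoint, hT]; simp)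
    (fun x => by
      rw [_root_.smul_apply, real_inner_smul_right]
      exact mul_nonneg (by positivity) (hpos x))
    (by
      rw [norm_smul, norm_inv, Real.norm_of_nonneg hc.le, inv_mul_le_one₀ hc]
      exact (lt_add_one _).le)
  refine ⟨√c • S, ?_, fun x => ?_, ?_, fun Z hZ => (h4 Z (hZ.smul_right _)).smul_right _⟩
  · rw [← star_eq_adjoint, star_smul, star_eq_adjoint, h1]; simp
  · rw [_root_.smul_apply, real_inner_smul_right]
    exact mul_nonneg (by positivity) (h2 x)
  · rw [smul_mul_smul_comm, h3, Real.mul_self_sqrt hc.le, smul_smul, mul_inv_cancel₀ hc.ne',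
      one_smul]

/-- Douglas factorization, in place of the polar decomposition: `Sx ↦ Tx` is a contraction on the
range of `S`. It extends to the closure, and by zero to the orthogonal complement. -/
theorem exists_mul_eq_of_norm_apply_le {S T : H →L[ℝ] H} (h : ∀ x, ‖T x‖ ≤ ‖S x‖) :
    ∃ W : H →L[ℝ] H, T = W * S := by
  let K : Submodule ℝ H := S.range.topologicalClosure
  have : CompleteSpace K := S.range.isClosed_topologicalClosure.completeSpace_coe
  let e : H →ₗ[ℝ] K := S.toLinearMap.codRestrict K
    fun x => S.range.le_topologicalClosure ⟨x, rfl⟩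
  have he : DenseRange e := by
    intro y
    rw [Topology.IsInducing.subtypeVal.closure_eq_preimage_closure_image]
    have hy := y.2
    rw [← SetLike.mem_coe, Submodule.topologicalClosure_coe] at hy
    refine closure_mono ?_ hy
    rintro _ ⟨x, rfl⟩
    exact ⟨e x, ⟨x, rfl⟩, rfl⟩
  refine ⟨(T.toLinearMap.extendOfNorm e).comp K.orthogonalProjectionOnto, ?_⟩
  ext x
  have hx : K.orthogonalProjectionOnto (S x) = e x :=
    K.orthogonalProjectionOnto_mem_subspace_eq_self (e x)
  rw [mul_apply_eq, comp_apply, hx, LinearMap.extendOfNorm_eq he ⟨1, fun x => ?_⟩]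
  · rfl
  · rw [one_mul]; exact h x

/-! ### Hilbert–Schmidt operators, their products and the trace -/

/-- Parseval in both bases and an exchange of summation for the nonnegative family `⟪c j, X (b
i)⟫²`. As `c` is arbitrary, a second application, to `X†`, gives independence of the basis. -/
theorem hasSum_norm_adjoint_sq {ι κ : Type*} (b : HilbertBasis ι ℝ H) (c : HilbertBasis κ ℝ H)
    {X : H →L[ℝ] H} (hX : Summable fun i => ‖X (b i)‖ ^ 2) :
    HasSum (fun j => ‖(X†) (c j)‖ ^ 2) (∑' i, ‖X (b i)‖ ^ 2) := by
  have h1 : ∀ i, HasSum (fun j => ⟪c j, X (b i)⟫_ℝ ^ 2) (‖X (b i)‖ ^ 2) := fun i => by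
    rw [← real_inner_self_eq_norm_sq]
    refine (c.hasSum_inner_mul_inner (X (b i)) (X (b i))).congr_fun fun j => ?_
    rw [sq, real_inner_comm (c j)]
  have h2 : ∀ j, HasSum (fun i => ⟪c j, X (b i)⟫_ℝ ^ 2) (‖(X†) (c j)‖ ^ 2) := fun j => by
    rw [← real_inner_self_eq_norm_sq]
    refine (b.hasSum_inner_mul_inner ((X†) (c j)) ((X†) (c j))).congr_fun fun i => ?_
    rw [adjoint_inner_left, adjoint_inner_right, sq, real_inner_comm (c j)]
  have h3 : Summable (fun p : ι × κ => ⟪c p.2, X (b p.1)⟫_ℝ ^ 2) := by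
    refine (summable_prod_of_nonneg fun p => sq_nonneg _).2 ⟨fun i => (h1 i).summable, ?_⟩
    exact hX.congr fun i => (h1 i).tsum_eq.symm
  have h4 : HasSum (fun p : ι × κ => ⟪c p.2, X (b p.1)⟫_ℝ ^ 2) (∑' i, ‖X (b i)‖ ^ 2) := by
    convert h3.hasSum using 1
    rw [h3.tsum_prod]
    exact tsum_congr fun i => (h1 i).tsum_eq.symm
  exact ((Equiv.prodComm κ ι).hasSum_iff.2 h4).prod_fiberwise h2

theorem isHilbertSchmidt_of_summable {ι : Type*} (b : HilbertBasis ι ℝ H) {X : H →L[ℝ] H}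
    (h : Summable fun i => ‖X (b i)‖ ^ 2) : IsHilbertSchmidt X := by
  obtain ⟨w, c, -⟩ := exists_hilbertBasis ℝ H
  have := hasSum_norm_adjoint_sq c c (hasSum_norm_adjoint_sq b c h).summable
  rw [adjoint_adjoint] at this
  exact ⟨w, c, this.summable⟩

namespace IsHilbertSchmidt

variable {X Y : H →L[ℝ] H}

protected theorem adjoint (hX : IsHilbertSchmidt X) : IsHilbertSchmidt (X†) :=
  let ⟨_, b, h⟩ := hX
  isHilbertSchmidt_of_summable b (hasSum_norm_adjoint_sq b b h).summable

theorem summable (hX : IsHilbertSchmidt X) {ι : Type*} (b : HilbertBasis ι ℝ H) :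
    Summable fun i => ‖X (b i)‖ ^ 2 := by
  obtain ⟨w, c, h⟩ := hX.adjoint
  have := hasSum_norm_adjoint_sq c b h
  rw [adjoint_adjoint] at this
  exact this.summable

theorem tsum_eq (hX : IsHilbertSchmidt X) {ι κ : Type*} (b : HilbertBasis ι ℝ H)
    (c : HilbertBasis κ ℝ H) : ∑' i, ‖X (b i)‖ ^ 2 = ∑' j, ‖X (c j)‖ ^ 2 := by
  have h1 := hasSum_norm_adjoint_sq b b (hX.summable b)
  have h2 := hasSum_norm_adjoint_sq b c h1.summable
  rw [adjoint_adjoint, h1.tsum_eq] at h2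
  exact h2.tsum_eq.symm

theorem mul_right (hX : IsHilbertSchmidt X) (A : H →L[ℝ] H) : IsHilbertSchmidt (X * A) := by
  have := (hX.adjoint.mul_left (A†)).adjoint
  simpa only [← star_eq_adjoint, star_mul, star_star] using this

theorem add (hX : IsHilbertSchmidt X) (hY : IsHilbertSchmidt Y) : IsHilbertSchmidt (X + Y) := by
  obtain ⟨w, b, h⟩ := hX
  refine ⟨w, b, ((h.add (hY.summable b)).mul_left 2).of_nonneg_of_le
    (fun i => sq_nonneg _) fun i => ?_⟩
  refine (pow_le_pow_left₀ (norm_nonneg _) (norm_add_le (X (b i)) (Y (b i))) 2).trans ?_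
  nlinarith [sq_nonneg (‖X (b i)‖ - ‖Y (b i)‖)]

end IsHilbertSchmidt

/-- Products of two Hilbert–Schmidt operators. -/
def IsNuclear (T : H →L[ℝ] H) : Prop :=
  ∃ X Y : H →L[ℝ] H, IsHilbertSchmidt X ∧ IsHilbertSchmidt Y ∧ T = X† * Y

namespace IsNuclear

variable {T : H →L[ℝ] H}

theorem mul_right (hT : IsNuclear T) (A : H →L[ℝ] H) : IsNuclear (T * A) := by
  obtain ⟨X, Y, hX, hY, rfl⟩ := hT
  exact ⟨X, Y * A, hX, hY.mul_right A, mul_assoc _ _ _⟩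

theorem mul_left (hT : IsNuclear T) (A : H →L[ℝ] H) : IsNuclear (A * T) := by
  obtain ⟨X, Y, hX, hY, rfl⟩ := hT
  refine ⟨X * A†, Y, hX.mul_right _, hY, ?_⟩
  simp only [← star_eq_adjoint, star_mul, star_star, mul_assoc]

/-- The trace of a nuclear operator does not depend on the Hilbert basis. -/
theorem exists_hasSum (hT : IsNuclear T) : ∃ t : ℝ, ∀ {ι : Type*} (b : HilbertBasis ι ℝ H),
    HasSum (fun i => ⟪b i, T (b i)⟫_ℝ) t := by
  obtain ⟨X, Y, hX, hY, rfl⟩ := hT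
  obtain ⟨w, c, -⟩ := exists_hilbertBasis ℝ H
  have hp := hX.add hY
  have hm : IsHilbertSchmidt (X - Y) := by
    simpa [sub_eq_add_neg] using hX.add (hY.mul_left (-1))
  -- Polarization writes the trace of `X† Y` through two Hilbert–Schmidt norms, which are basis
  -- independent.
  refine ⟨4⁻¹ * (∑' i, ‖(X + Y) (c i)‖ ^ 2 - ∑' i, ‖(X - Y) (c i)‖ ^ 2), fun b => ?_⟩
  rw [hp.tsum_eq c b, hm.tsum_eq c b]
  refine (((hp.summable b).hasSum.sub (hm.summable b).hasSum).mul_left (4⁻¹ : ℝ)).congr_fun fun i => ?_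
  rw [mul_apply_eq, adjoint_inner_right]
  rw [_root_.add_apply, _root_.sub_apply, norm_add_sq_real, norm_sub_sq_real]
  ring

end IsNuclear

/-- If the modulus `S` of `T` has finite trace, `T` is nuclear. -/
theorem isNuclear_of_summable_abs {S T : H →L[ℝ] H} (hS : S† = S)
    (hpos : ∀ x, 0 ≤ ⟪x, S x⟫_ℝ) (hST : S * S = T† * T) {ι : Type*} (b : HilbertBasis ι ℝ H)
    (h : Summable fun i => ⟪b i, S (b i)⟫_ℝ) : IsNuclear T := by
  -- The summands `⟪b i, S (b i)⟫` equal `‖R (b i)‖²`, so `S = R† R` is a product of Hilbert–Schmidt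
  -- operators.
  obtain ⟨R, hR, -, hRS, -⟩ := exists_sqrt hS hpos
  have hRb : IsHilbertSchmidt R := by
    refine isHilbertSchmidt_of_summable b (h.congr fun i => ?_)
    rw [← hRS, mul_apply_eq, ← adjoint_inner_left, hR, real_inner_self_eq_norm_sq]
  obtain ⟨W, rfl⟩ := exists_mul_eq_of_norm_apply_le (S := S) (T := T) fun x => by
    refine le_of_sq_le_sq ?_ (norm_nonneg _)
    rw [← real_inner_self_eq_norm_sq, ← real_inner_self_eq_norm_sq, ← adjoint_inner_right S,
      ← adjoint_inner_right T, hS, ← mul_apply_eq, ← mul_apply_eq, hST]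
  refine IsNuclear.mul_left ⟨R, R, hRb, hRb, ?_⟩ W
  rw [hR, hRS]

/-- Every nuclear operator has a nuclear modulus. -/
theorem IsNuclear.exists_abs {T : H →L[ℝ] H} (hT : IsNuclear T) :
    ∃ S : H →L[ℝ] H, S† = S ∧ (∀ x, 0 ≤ ⟪x, S x⟫_ℝ) ∧ S * S = T† * T ∧
      (∀ Z : H →L[ℝ] H, Commute Z (T† * T) → Commute Z S) ∧ IsNuclear S := by
  obtain ⟨S, hS, hpos, hST, hcomm⟩ := exists_sqrt (T := T† * T)
    (by simp only [← star_eq_adjoint, star_mul, star_star])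
    (fun x => by
      rw [mul_apply_eq, adjoint_inner_right]
      exact real_inner_self_nonneg)
  refine ⟨S, hS, hpos, hST, hcomm, ?_⟩
  obtain ⟨W, rfl⟩ := exists_mul_eq_of_norm_apply_le (S := T) (T := S) fun x => by
    refine le_of_sq_le_sq ?_ (norm_nonneg _)
    rw [← real_inner_self_eq_norm_sq, ← real_inner_self_eq_norm_sq, ← adjoint_inner_right S,
      ← adjoint_inner_right T, hS, ← mul_apply_eq, ← mul_apply_eq, hST]
  exact hT.mul_left W

end RealHilbert

/-! ### Passing between `D` and `ℝ` -/

section RealFrames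

open ContinuousLinearMap
open scoped InnerProductSpace InnerProduct

universe u

/-- The data that present a `D`-valued scalar product in terms of a real one: a real basis `c` of
`D` with coordinates `coord` and distinguished element `c o = 1`, and the real isometries `J g` by
which the scalars `c g` act on `H`, such that `⟨x|y⟩ = ∑ g, ⟪J g x, y⟫ c g` and the `R`-linear
operators are the real-linear ones which commute with all `J g`. -/
structure RealFrame (D R : Type*) (H : Type u) (G : Type) [Fintype G] [DecidableEq G]
    [NormedRing D] [NormedAlgebra ℝ D] [StarRing D] [Semiring R]
    [NormedAddCommGroup H] [InnerProductSpace ℝ H] [Module R H] [Inner D H] where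
  c : G → D
  coord : G → D →L[ℝ] ℝ
  J : G → H ≃ₗᵢ[ℝ] H
  o : G
  coord_c : ∀ g h, coord g (c h) = if g = h then 1 else 0
  c_o : c o = 1
  re_eq : ∀ s : D, (2⁻¹ : ℝ) • (s + star s) = algebraMap ℝ D (coord o s)
  J_o : ∀ x, J o x = x
  inner_eq : ∀ x y : H, inner D x y = ∑ g, ⟪J g x, y⟫_ℝ • c g
  -- Since `k ≠ o`, for a unit vector `u` the right side at `x = y = u` is an imaginary coordinate
  -- of `⟨u|u⟩ = 1`, hence zero; so distinct `J g u` are orthogonal.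
  inner_J : ∀ g h, g ≠ h → ∃ k, k ≠ o ∧ ∃ ε : ℝ, ∀ x y : H, ⟪J g x, J h y⟫_ℝ = ε * ⟪J k x, y⟫_ℝ
  J_skew : ∀ g, g ≠ o → ∀ x y : H, ⟪J g x, y⟫_ℝ = -⟪x, J g y⟫_ℝ
  map_real_smul : ∀ (T : H →L[R] H) (r : ℝ) (x : H), T (r • x) = r • T x
  map_J : ∀ (T : H →L[R] H) (g : G) (x : H), T (J g x) = J g (T x)
  exists_lift : ∀ T : H →L[ℝ] H, (∀ g x, T (J g x) = J g (T x)) → ∃ T' : H →L[R] H, ∀ x, T' x = T x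

namespace RealFrame

variable {D R : Type*} {H : Type u} {G : Type} [Fintype G] [DecidableEq G]
  [NormedRing D] [NormedAlgebra ℝ D] [StarRing D] [Semiring R]
  [NormedAddCommGroup H] [InnerProductSpace ℝ H] [Module R H] [Inner D H]
  (F : RealFrame D R H G)

theorem coord_inner (g : G) (x y : H) : F.coord g (inner D x y) = ⟪F.J g x, y⟫_ℝ := by
  simp [F.inner_eq, F.coord_c]

theorem coord_one (g : G) : F.coord g 1 = if g = F.o then 1 else 0 := by
  rw [← F.c_o, F.coord_c]

theorem re_inner (x y : H) : F.coord F.o (inner D x y) = ⟪x, y⟫_ℝ := by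
  rw [F.coord_inner, F.J_o]

theorem inner_eq_of_real {a b x y : H} (h : ∀ g, ⟪F.J g a, b⟫_ℝ = ⟪F.J g x, y⟫_ℝ) :
    (inner D a b : D) = inner D x y := by
  simp only [F.inner_eq, h]

/-- Restriction of scalars. -/
def toReal (T : H →L[R] H) : H →L[ℝ] H where
  toFun := T
  map_add' := map_add T
  map_smul' := F.map_real_smul T
  cont := T.continuous

theorem toReal_apply (T : H →L[R] H) (x : H) : F.toReal T x = T x := rfl

variable [CompleteSpace H]

theorem exists_hilbertBasis {N : Set H} (hN : IsHilbertBasis D N) :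
    ∃ b : HilbertBasis (N × G) ℝ H, ∀ p, b p = F.J p.2 p.1 := by
  have hself : ∀ u ∈ N, ∀ g, ⟪F.J g u, u⟫_ℝ = if g = F.o then 1 else 0 := fun u hu g => by
    rw [← F.coord_inner, hN.norm_one u hu, F.coord_one]
  have hne : ∀ u ∈ N, ∀ v ∈ N, u ≠ v → ∀ g, ⟪F.J g u, v⟫_ℝ = 0 := fun u hu v hv huv g => by
    rw [← F.coord_inner, hN.orthogonal u hu v hv huv, map_zero]
  have ho : Orthonormal ℝ fun p : N × G => F.J p.2 (p.1 : H) := by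
    classical
    rw [orthonormal_iff_ite]
    rintro ⟨⟨u, hu⟩, g⟩ ⟨⟨v, hv⟩, h⟩
    by_cases hgh : g = h
    · subst hgh
      rw [LinearIsometryEquiv.inner_map_map]
      have hJo := congrArg (fun w => ⟪w, v⟫_ℝ) (F.J_o u)
      refine hJo.symm.trans ?_
      by_cases huv : u = v
      · subst huv
        refine (hself u hu _).trans ?_
        simp
      · refine (hne u hu v hv huv _).trans ?_
        simp [huv]
    · obtain ⟨k, hk, ε, hε⟩ := F.inner_J g h hgh
      rw [hε, if_neg (by simp [hgh])]
      by_cases huv : u = v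
      · subst huv
        rw [hself u hu, if_neg hk, mul_zero]
      · rw [hne u hu v hv huv, mul_zero]
  refine ⟨HilbertBasis.mkOfOrthogonalEqBot ho ?_, fun p => by
    rw [HilbertBasis.coe_mkOfOrthogonalEqBot]⟩
  rw [Submodule.eq_bot_iff]
  intro x hx
  refine hN.complete x fun u hu => ?_
  rw [F.inner_eq]
  refine Finset.sum_eq_zero fun g _ => ?_
  rw [hx _ (Submodule.subset_span ⟨(⟨u, hu⟩, g), rfl⟩), zero_smul]

theorem adjoint_toReal {T' T : H →L[R] H} (h : IsAdjointOf D T' T) :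
    (F.toReal T)† = F.toReal T' := by
  refine ((ContinuousLinearMap.eq_adjoint_iff _ _).2 fun x y => ?_).symm
  rw [← F.re_inner, ← F.re_inner, F.toReal_apply, F.toReal_apply, h]

theorem isAdjointOf {T' T : H →L[R] H} (h : (F.toReal T)† = F.toReal T') :
    IsAdjointOf D T' T := fun x y => F.inner_eq_of_real fun g => by
  rw [← F.map_J, ← F.toReal_apply, ← h, adjoint_inner_left, toReal_apply]

theorem adjoint_toReal_J (T : H →L[R] H) (g : G) (x : H) :
    ((F.toReal T)†) (F.J g x) = F.J g (((F.toReal T)†) x) := by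
  refine ext_inner_right ℝ fun y => ?_
  rw [adjoint_inner_left, LinearIsometryEquiv.inner_map_eq_flip,
    LinearIsometryEquiv.inner_map_eq_flip, adjoint_inner_left]
  congr 1
  rw [LinearIsometryEquiv.symm_apply_eq, toReal_apply, toReal_apply, ← F.map_J,
    LinearIsometryEquiv.apply_symm_apply]

theorem isNuclear {T : H →L[R] H} (hT : IsTraceClass D T) : IsNuclear (F.toReal T) := by
  obtain ⟨S, ⟨hS, hpos, T', hT', hST⟩, N, hN, hsum⟩ := hT
  obtain ⟨b, hb⟩ := F.exists_hilbertBasis hN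
  refine isNuclear_of_summable_abs (S := F.toReal S) (F.adjoint_toReal hS) (fun x => ?_) ?_ b ?_
  · obtain ⟨r, hr, h⟩ := hpos x
    rw [toReal_apply, ← F.re_inner, h, Algebra.algebraMap_eq_smul_one, map_smul, F.coord_one]
    simpa using hr
  · rw [F.adjoint_toReal hT']
    ext x
    exact DFunLike.congr_fun hST x
  · have h1 : Summable fun u : N => ⟪(u : H), S (u : H)⟫_ℝ := by
      simpa only [Function.comp_def, F.re_inner] using hsum.map (F.coord F.o) (F.coord F.o).continuous
    have h2 : Summable fun p : N × G => ⟪(p.1 : H), S (p.1 : H)⟫_ℝ := by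
      simpa using h1.mul_of_nonneg (f := fun u : N => ⟪(u : H), S (u : H)⟫_ℝ)
        (g := fun _ : G => (1 : ℝ)) (Summable.of_finite)
        (fun u => by
          obtain ⟨r, hr, h⟩ := hpos u
          change 0 ≤ ⟪(u : H), S (u : H)⟫_ℝ
          rw [← F.re_inner, h, Algebra.algebraMap_eq_smul_one, map_smul, F.coord_one]
          simpa using hr) (fun _ => zero_le_one)
    refine h2.congr fun p => ?_
    rw [hb, toReal_apply, F.map_J, LinearIsometryEquiv.inner_map_map]

theorem summable_inner_J {N : Set H} (hN : IsHilbertBasis D N) {T : H →L[R] H}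
    (hT : IsNuclear (F.toReal T)) (g : G) : Summable fun u : N => ⟪F.J g u, T u⟫_ℝ := by
  obtain ⟨b, hb⟩ := F.exists_hilbertBasis hN
  obtain ⟨t, ht⟩ := (hT.mul_left ((F.J g : H →L[ℝ] H)†)).exists_hasSum
  refine ((ht b).summable.comp_injective (i := fun u : N => (u, F.o))
    fun u v h => (Prod.ext_iff.1 h).1).congr fun u => ?_
  rw [Function.comp_apply, hb, F.J_o, mul_apply_eq, adjoint_inner_right]
  rfl

theorem summable_inner {N : Set H} (hN : IsHilbertBasis D N) {T : H →L[R] H}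
    (hT : IsNuclear (F.toReal T)) : Summable fun u : N => inner D (u : H) (T (u : H)) := by
  simp only [F.inner_eq]
  exact summable_sum fun g _ => (F.summable_inner_J hN hT g).smul_const (F.c g)

/-- The real modulus commutes with every `J g` because `T† T` does, so it lifts to an `R`-linear
operator. -/
theorem isTraceClass {N : Set H} (hN : IsHilbertBasis D N) {T : H →L[R] H}
    (hT : IsNuclear (F.toReal T)) : IsTraceClass D T := by
  obtain ⟨S₀, hS, hpos, hST, hcomm, hnuc⟩ := hT.exists_abs
  have hJ : ∀ g x, S₀ (F.J g x) = F.J g (S₀ x) := fun g x => by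
    have : Commute (F.J g : H →L[ℝ] H) S₀ := hcomm _ <| by
      ext x
      change F.J g (((F.toReal T)†) (F.toReal T x)) =
        ((F.toReal T)†) (F.toReal T (F.J g x))
      rw [toReal_apply, toReal_apply, F.map_J, F.adjoint_toReal_J]
    exact (DFunLike.congr_fun this.eq x).symm
  obtain ⟨S, hSS⟩ := F.exists_lift S₀ hJ
  obtain ⟨T', hT'⟩ := F.exists_lift ((F.toReal T)†) (F.adjoint_toReal_J T)
  have hS₀ : F.toReal S = S₀ := ContinuousLinearMap.ext hSS
  subst hS₀
  refine ⟨S, ⟨F.isAdjointOf hS, fun x => ⟨⟪x, S x⟫_ℝ, hpos x, ?_⟩, T',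
    F.isAdjointOf (ContinuousLinearMap.ext fun x => (hT' x).symm), ?_⟩, N, hN,
    F.summable_inner hN hnuc⟩
  · rw [F.inner_eq, Finset.sum_eq_single F.o, F.J_o, F.c_o, Algebra.algebraMap_eq_smul_one]
    · intro g _ hg
      -- `J g` is skew and commutes with the self-adjoint `S`, so this number is its own negative:
      -- `⟨x|Sx⟩` has no imaginary part.
      have h1 : ⟪F.J g x, S x⟫_ℝ = -⟪S x, F.J g x⟫_ℝ := by
        rw [F.J_skew g hg, ← F.map_J, ← F.toReal_apply, ← adjoint_inner_left, hS, F.toReal_apply]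
      rw [real_inner_comm] at h1
      rw [real_inner_comm, show ⟪S x, F.J g x⟫_ℝ = 0 by linarith, zero_smul]
    · simp
  · ext x
    exact (DFunLike.congr_fun hST x).trans (hT' (T x)).symm

/-- Group the real basis `J g u` by `u`: `T` commutes with the isometries `J g`, so each of the
`card G` terms equals `⟪u, T u⟫`. -/
theorem hasRealTrace {N : Set H} (hN : IsHilbertBasis D N) {T : H →L[R] H}
    (hT : IsNuclear (F.toReal T)) {t : ℝ} (ht : ∀ {ι : Type u} (b : HilbertBasis ι ℝ H),
      HasSum (fun i => ⟪b i, T (b i)⟫_ℝ) t) :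
    HasRealTrace D T (t / Fintype.card G) := by
  refine ⟨F.isTraceClass hN hT, fun M hM => ⟨_, (F.summable_inner hM hT).hasSum, ?_⟩⟩
  rw [F.re_eq]
  congr 1
  obtain ⟨b, hb⟩ := F.exists_hilbertBasis hM
  have h1 : HasSum (fun u : M => ⟪(u : H), T u⟫_ℝ)
      (F.coord F.o (∑' u : M, inner D (u : H) (T (u : H)))) := by
    simpa only [Function.comp_def, F.re_inner] using
      (F.summable_inner hM hT).hasSum.map (F.coord F.o) (F.coord F.o).continuous
  have h2 : HasSum (fun u : M => (Fintype.card G : ℝ) * ⟪(u : H), T u⟫_ℝ) t := by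
    refine (ht b).prod_fiberwise fun u => ?_
    have := hasSum_fintype fun g : G => ⟪b (u, g), T (b (u, g))⟫_ℝ
    simpa [hb, F.map_J] using this
  have hcard : (Fintype.card G : ℝ) ≠ 0 := by
    have : Nonempty G := ⟨F.o⟩
    exact_mod_cast Fintype.card_ne_zero
  rw [eq_div_iff hcard, mul_comm]
  exact (h1.mul_left _).unique h2

/-- `C₁` in the basis `V b` and `C₂` in the basis `b` have the same diagonal entries. The pointwise
hypotheses require `V` to be only real-linear. -/
theorem exists_hasRealTrace (F : RealFrame D R H G) (V : H ≃ₗᵢ[ℝ] H) {A B C₁ C₂ : H →L[R] H}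
    (h₁ : ∀ x, C₁ x = A (V (B (V.symm x)))) (h₂ : ∀ x, C₂ x = V.symm (A (V (B x))))
    (h : IsTraceClass D A ∨ IsTraceClass D B) :
    ∃ r, HasRealTrace D C₁ r ∧ HasRealTrace D C₂ r := by
  obtain ⟨N, hN⟩ : ∃ N : Set H, IsHilbertBasis D N := by
    rcases h with ⟨-, -, N, hN, -⟩ | ⟨-, -, N, hN, -⟩ <;> exact ⟨N, hN⟩
  have e₁ : F.toReal C₁ = F.toReal A * ((V : H →L[ℝ] H) * F.toReal B * (V.symm : H →L[ℝ] H)) :=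
    ContinuousLinearMap.ext h₁
  have e₂ : F.toReal C₂ = (V.symm : H →L[ℝ] H) * F.toReal A * ((V : H →L[ℝ] H) * F.toReal B) :=
    ContinuousLinearMap.ext h₂
  have n₁ : IsNuclear (F.toReal C₁) := by
    rw [e₁]
    rcases h with h | h
    · exact (F.isNuclear h).mul_right _
    · exact (((F.isNuclear h).mul_left _).mul_right _).mul_left _
  have n₂ : IsNuclear (F.toReal C₂) := by
    rw [e₂]
    rcases h with h | h
    · exact ((F.isNuclear h).mul_left _).mul_right _
    · exact ((F.isNuclear h).mul_left _).mul_left _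
  obtain ⟨t, ht⟩ := n₁.exists_hasSum
  refine ⟨_, F.hasRealTrace hN n₁ ht, F.hasRealTrace hN n₂ fun b => ?_⟩
  refine (ht (HilbertBasis.ofRepr (V.symm.trans b.repr))).congr_fun fun i => ?_
  have hb : HilbertBasis.ofRepr (V.symm.trans b.repr) i = V (b i) := rfl
  rw [hb, toReal_apply, h₁, h₂, V.symm_apply_apply, ← V.inner_map_eq_flip]

end RealFrame

end RealFrames

/-! ### The real, complex and quaternionic frames -/

section Instances

universe u

/-- Real Hilbert spaces. -/
noncomputable def realFrame (H : Type u) [NormedAddCommGroup H] [InnerProductSpace ℝ H] :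
    RealFrame ℝ ℝ H Unit where
  c _ := 1
  coord _ := ContinuousLinearMap.id ℝ ℝ
  J _ := LinearIsometryEquiv.refl ℝ H
  o := ()
  coord_c := by simp
  c_o := rfl
  re_eq s := by simp; ring
  J_o _ := rfl
  inner_eq x y := by simp
  inner_J g h hgh := absurd rfl hgh
  J_skew g hg := absurd rfl hg
  map_real_smul T := map_smul T
  map_J _ _ _ := rfl
  exists_lift T _ := ⟨T, fun _ => rfl⟩

/-- Multiplication by `i` as a real isometry. -/
noncomputable def complexUnitIsometry (H : Type u) [NormedAddCommGroup H] [InnerProductSpace ℂ H] :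
    letI := InnerProductSpace.complexToReal (G := H)
    H ≃ₗᵢ[ℝ] H :=
  letI := InnerProductSpace.complexToReal (G := H)
  { toFun := fun x => Complex.I • x
    invFun := fun x => (-Complex.I) • x
    left_inv := fun x => by simp [smul_smul]
    right_inv := fun x => by simp [smul_smul]
    map_add' := smul_add _
    map_smul' := fun r x => smul_comm _ _ _
    norm_map' := fun x => by
      change ‖Complex.I • x‖ = ‖x‖
      simp [norm_smul] }

/-- Complex Hilbert spaces. -/
noncomputable def complexFrame (H : Type u) [NormedAddCommGroup H] [InnerProductSpace ℂ H] :
    letI := InnerProductSpace.complexToReal (G := H)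
    RealFrame ℂ ℂ H Bool :=
  letI := InnerProductSpace.complexToReal (G := H)
  have hI : ∀ x y : H, inner ℝ (Complex.I • x) y = (inner ℂ x y).im := fun x y => by
    rw [real_inner_eq_re_inner ℂ, inner_smul_left]
    simp
  have hre : ∀ x y : H, inner ℝ x y = (inner ℂ x y).re := fun x y => rfl
  { c := fun g => if g then Complex.I else 1
    coord := fun g => if g then Complex.imCLM else Complex.reCLM
    J := fun g => if g then complexUnitIsometry H else LinearIsometryEquiv.refl ℝ H
    o := false
    coord_c := by rintro (_ | _) (_ | _) <;> simp
    c_o := rfl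
    re_eq := fun s => by apply Complex.ext <;> simp; ring
    J_o := fun _ => rfl
    inner_eq := fun x y => by
      have h1 : complexUnitIsometry H x = Complex.I • x := rfl
      apply Complex.ext <;> simp [h1, hre]
    inner_J := by
      have h1 : ∀ x, complexUnitIsometry H x = Complex.I • x := fun _ => rfl
      rintro (_ | _) (_ | _) h
      · exact absurd rfl h
      · refine ⟨true, by simp, -1, fun x y => ?_⟩
        simp [h1, hI, hre]
      · refine ⟨true, by simp, 1, fun x y => ?_⟩
        simp
      · exact absurd rfl h
    J_skew := by
      have h1 : ∀ x, complexUnitIsometry H x = Complex.I • x := fun _ => rfl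
      rintro (_ | _) h x y
      · exact absurd rfl h
      · simp [h1, hI, hre]
    map_real_smul := fun T r x => by
      rw [← Complex.coe_smul, map_smul, Complex.coe_smul]
    map_J := by
      rintro T (_ | _) x
      · rfl
      · exact map_smul T Complex.I x
    exists_lift := fun T hT => by
      have hTI : ∀ x, T (Complex.I • x) = Complex.I • T x := hT true
      refine ⟨⟨⟨⟨T, map_add T⟩, fun z x => ?_⟩, T.continuous⟩, fun _ => rfl⟩
      change T (z • x) = z • T x
      conv_lhs => rw [← Complex.re_add_im z, add_smul, mul_comm, mul_smul, map_add, hTI]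
      conv_rhs => rw [← Complex.re_add_im z, add_smul, mul_comm, mul_smul]
      simp only [Complex.coe_smul, map_smul] }

namespace QuaternionicInnerProductSpace

variable {H : Type u} [NormedAddCommGroup H] [QuaternionicInnerProductSpace H]

theorem inner_smul_left (x y : H) (q : ℍ) : inner ℍ (op q • x) y = star q * inner ℍ x y := by
  rw [← star_inner, QuaternionicInnerProductSpace.inner_smul_right, star_mul, star_inner]

theorem inner_add_left (x y z : H) : inner ℍ (x + y) z = inner ℍ x z + inner ℍ y z := by
  rw [← star_inner, QuaternionicInnerProductSpace.inner_add_right, star_add, star_inner, star_inner]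

theorem norm_op_smul (q : ℍ) (x : H) : ‖op q • x‖ = ‖q‖ * ‖x‖ := by
  have h := QuaternionicInnerProductSpace.inner_self_eq_norm_sq (op q • x)
  rw [inner_smul_left, QuaternionicInnerProductSpace.inner_smul_right,
    QuaternionicInnerProductSpace.inner_self_eq_norm_sq, ← mul_assoc,
    ← Quaternion.coe_commutes, mul_assoc, Quaternion.star_mul_self, ← Quaternion.coe_mul,
    Quaternion.coe_inj, Quaternion.normSq_eq_norm_mul_self] at h
  rw [← sq_eq_sq₀ (norm_nonneg _) (by positivity), ← h]
  ring

variable (H)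

/-- The real Hilbert space underlying a quaternionic one. -/
noncomputable abbrev toRealInnerProductSpace : InnerProductSpace ℝ H where
  toModule := Module.compHom H (algebraMap ℝ ℍᵐᵒᵖ)
  norm_smul_le r x := by
    refine (norm_op_smul (algebraMap ℝ ℍ r) x).le.trans ?_
    rw [norm_algebraMap']
  inner x y := (inner ℍ x y).re
  norm_sq_eq_re_inner x := by
    rw [QuaternionicInnerProductSpace.inner_self_eq_norm_sq]; rfl
  conj_inner_symm x y := by
    rw [← star_inner]; simp
  add_left x y z := by
    rw [inner_add_left]; simp
  smul_left x y r := by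
    change (inner ℍ (op (algebraMap ℝ ℍ r) • x) y).re = _
    rw [inner_smul_left]
    simp

variable {H}

/-- Multiplication by a unit quaternion as a real isometry. -/
noncomputable def unitIsometry (q : ℍ) (h₁ : q * star q = 1) (h₂ : star q * q = 1)
    (hq : ‖q‖ = 1) :
    letI := toRealInnerProductSpace H
    H ≃ₗᵢ[ℝ] H :=
  letI := toRealInnerProductSpace H
  { toFun := fun x => op q • x
    invFun := fun x => op (star q) • x
    left_inv := fun x => by
      beta_reduce
      rw [smul_smul, ← op_mul, h₁, op_one, one_smul]
    right_inv := fun x => by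
      beta_reduce
      rw [smul_smul, ← op_mul, h₂, op_one, one_smul]
    map_add' := smul_add _
    map_smul' := fun r x => by
      change op q • op (algebraMap ℝ ℍ r) • x = op (algebraMap ℝ ℍ r) • op q • x
      rw [smul_smul, smul_smul, ← op_mul, ← op_mul, Algebra.commutes]
    norm_map' := fun x => by
      change ‖op q • x‖ = ‖x‖
      rw [norm_op_smul, hq, one_mul] }

/-- The quaternion units `1, i, j, k`. -/
def units (g : Fin 4) : ℍ :=
  ⟨if g = 0 then 1 else 0, if g = 1 then 1 else 0, if g = 2 then 1 else 0, if g = 3 then 1 else 0⟩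

theorem re_units (g : Fin 4) : (units g).re = if g = 0 then 1 else 0 := rfl

theorem imI_units (g : Fin 4) : (units g).imI = if g = 1 then 1 else 0 := rfl

theorem imJ_units (g : Fin 4) : (units g).imJ = if g = 2 then 1 else 0 := rfl

theorem imK_units (g : Fin 4) : (units g).imK = if g = 3 then 1 else 0 := rfl

theorem normSq_units (g : Fin 4) : Quaternion.normSq (units g) = 1 := by
  rw [Quaternion.normSq_def']
  fin_cases g <;> simp [re_units, imI_units, imJ_units, imK_units]

theorem exists_units_mul_star (g h : Fin 4) (hgh : g ≠ h) :
    ∃ k, k ≠ 0 ∧ ∃ ε : ℝ, units g * star (units h) = ε • units k := by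
  -- Up to sign the units multiply as the Klein four-group, whose table this is; `ε` is the matching
  -- coordinate of the product.
  let k : Fin 4 := (![![0, 1, 2, 3], ![1, 0, 3, 2], ![2, 3, 0, 1], ![3, 2, 1, 0]] :
    Fin 4 → Fin 4 → Fin 4) g h
  refine ⟨k, ?_, (star (units k) * (units g * star (units h))).re, ?_⟩
  · revert g h; decide
  · fin_cases g <;> fin_cases h <;> first
      | exact absurd rfl hgh
      | (ext <;> simp [k, re_units, imI_units, imJ_units, imK_units])

theorem re_mul_comm (p q : ℍ) : (p * q).re = (q * p).re := by
  simp only [Quaternion.re_mul]; ring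

/-- Quaternionic Hilbert spaces. -/
noncomputable def quaternionFrame (H : Type u) [NormedAddCommGroup H]
    [QuaternionicInnerProductSpace H] :
    letI := toRealInnerProductSpace H
    RealFrame ℍ ℍᵐᵒᵖ H (Fin 4) :=
  letI := toRealInnerProductSpace H
  have hre : ∀ x y : H, inner ℝ x y = (inner ℍ x y).re := fun x y => rfl
  let J : Fin 4 → H ≃ₗᵢ[ℝ] H := fun g => unitIsometry (units g)
    (by rw [Quaternion.self_mul_star, normSq_units]; simp)
    (by rw [Quaternion.star_mul_self, normSq_units]; simp)
    (by
      have := Quaternion.normSq_eq_norm_mul_self (units g)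
      rw [normSq_units] at this
      nlinarith [norm_nonneg (units g)])
  have hJ : ∀ g x, J g x = op (units g) • x := fun _ _ => rfl
  have hJl : ∀ g x y, inner ℍ (J g x) y = star (units g) * inner ℍ x y := fun g x y =>
    inner_smul_left _ _ _
  have hJr : ∀ g x y, inner ℍ x (J g y) = inner ℍ x y * units g := fun g x y =>
    QuaternionicInnerProductSpace.inner_smul_right _ _ _
  { c := units
    coord := fun g =>
      { toFun := fun q => (star (units g) * q).re
        map_add' := fun p q => by rw [mul_add, Quaternion.re_add]
        map_smul' := fun r q => by simp
        cont := Quaternion.continuous_re.comp (continuous_const.mul continuous_id) }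
    J := J
    o := 0
    coord_c := fun g h => by
      change (star (units g) * units h).re = _
      fin_cases g <;> fin_cases h <;> simp [re_units, imI_units, imJ_units, imK_units]
    c_o := by ext <;> simp [re_units, imI_units, imJ_units, imK_units]
    re_eq := fun s => by
      change _ = algebraMap ℝ ℍ (star (units 0) * s).re
      ext <;> simp [re_units, imI_units, imJ_units, imK_units, Quaternion.algebraMap_def]
      ring
    J_o := fun x => by
      rw [hJ, show units 0 = 1 by ext <;> simp [re_units, imI_units, imJ_units, imK_units], op_one, one_smul]
    inner_eq := fun x y => by
      simp only [hre, hJl, Fin.sum_univ_four]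
      ext <;> simp [re_units, imI_units, imJ_units, imK_units]
    inner_J := fun g h hgh => by
      obtain ⟨k, hk, ε, hε⟩ := exists_units_mul_star g h hgh
      refine ⟨k, hk, ε, fun x y => ?_⟩
      rw [hre, hre, hJl, hJl, hJr, ← mul_assoc, re_mul_comm, ← mul_assoc,
        ← star_star (units h), ← star_mul, hε]
      simp
    J_skew := fun g hg x y => by
      rw [hre, hre, hJl, hJr, re_mul_comm _ (units g)]
      have : star (units g) = -units g := by
        fin_cases g
        · exact absurd rfl hg
        all_goals ext <;> simp [re_units, imI_units, imJ_units, imK_units]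
      rw [this, neg_mul, Quaternion.re_neg]
    map_real_smul := fun T r x => map_smul T (op (algebraMap ℝ ℍ r)) x
    map_J := fun T g x => map_smul T (op (units g)) x
    exists_lift := fun T hT => by
      -- Right multiplication by `q` is a real combination of the `J g`, so real-linearity and
      -- commutation with them give quaternionic linearity.
      have hexp : ∀ (q : ℍ) (x : H), op q • x = ∑ g, (star (units g) * q).re • J g x := by
        intro q x
        have h1 : ∀ (r : ℝ) g, r • J g x = op (r • units g) • x := fun r g => by
          change op (algebraMap ℝ ℍ r) • op (units g) • x = _
          rw [smul_smul, ← op_mul, ← Algebra.commutes, ← Algebra.smul_def]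
        simp only [h1, Fin.sum_univ_four, ← add_smul, ← op_add]
        congr 2
        ext <;> simp [re_units, imI_units, imJ_units, imK_units]
      refine ⟨⟨⟨⟨T, map_add T⟩, fun z x => ?_⟩, T.continuous⟩, fun _ => rfl⟩
      change T (z • x) = z • T x
      rw [← op_unop z, hexp, hexp, map_sum]
      simp only [map_smul, hT] }

end QuaternionicInnerProductSpace

end Instances

/-! ### Conjugation by `U` -/

section UnitaryConjugation

universe u

/-- Only real homogeneity of `U` enters, so the anti-unitary case needs no separate argument:
conjugation fixes real scalars. A state is trace class, so the projector case is a specialization.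
-/
theorem RealFrame.exists_hasRealTrace_conjOp {D R : Type*} {H : Type u} {G : Type} [Fintype G]
    [DecidableEq G] [NormedRing D] [NormedAlgebra ℝ D] [StarRing D] [Semiring R]
    [NormedAddCommGroup H] [InnerProductSpace ℝ H] [Module R H] [Inner D H] [CompleteSpace H]
    (F : RealFrame D R H G) {σ σ' : R →+* R} [RingHomInvPair σ σ'] [RingHomInvPair σ' σ]
    (U : H ≃ₛₗᵢ[σ] H) (hU : ∀ (r : ℝ) (x : H), U (r • x) = r • U x) :
    (∀ A B : H →L[R] H, IsTraceClass D A ∨ IsTraceClass D B →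
      ∃ r : ℝ, HasRealTrace D (A * conjOp U B) r ∧ HasRealTrace D (conjOp U.symm A * B) r) ∧
    (∀ P T : H →L[R] H, IsOrthogonalProjector D P → IsQuantumState D T →
      ∃ r : ℝ, HasRealTrace D (P * conjOp U T) r ∧ HasRealTrace D (conjOp U.symm P * T) r) := by
  let V : H ≃ₗᵢ[ℝ] H :=
    { toFun := U
      invFun := U.symm
      left_inv := U.symm_apply_apply
      right_inv := U.apply_symm_apply
      map_add' := map_add U
      map_smul' := hU
      norm_map' := U.norm_map }
  have key : ∀ A B : H →L[R] H, IsTraceClass D A ∨ IsTraceClass D B →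
      ∃ r : ℝ, HasRealTrace D (A * conjOp U B) r ∧ HasRealTrace D (conjOp U.symm A * B) r :=
    fun A B h => F.exists_hasRealTrace V (fun _ => rfl) (fun _ => rfl) h
  exact ⟨key, fun P T _ hT => key P T (.inr hT.2.2.1)⟩

end UnitaryConjugation

theorem proposition4p2 :
    -- real Hilbert spaces
    (∀ (H : Type*) [NormedAddCommGroup H] [InnerProductSpace ℝ H] [CompleteSpace H]
      (U : H ≃ₗᵢ[ℝ] H),
      (∀ A B : H →L[ℝ] H, IsTraceClass ℝ A ∨ IsTraceClass ℝ B →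
        ∃ r : ℝ, HasRealTrace ℝ (A * conjOp U B) r ∧ HasRealTrace ℝ (conjOp U.symm A * B) r) ∧
      (∀ P T : H →L[ℝ] H, IsOrthogonalProjector ℝ P → IsQuantumState ℝ T →
        ∃ r : ℝ, HasRealTrace ℝ (P * conjOp U T) r ∧ HasRealTrace ℝ (conjOp U.symm P * T) r)) ∧
    -- complex Hilbert spaces, `U` unitary
    (∀ (H : Type*) [NormedAddCommGroup H] [InnerProductSpace ℂ H] [CompleteSpace H]
      (U : H ≃ₗᵢ[ℂ] H),
      (∀ A B : H →L[ℂ] H, IsTraceClass ℂ A ∨ IsTraceClass ℂ B →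
        ∃ r : ℝ, HasRealTrace ℂ (A * conjOp U B) r ∧ HasRealTrace ℂ (conjOp U.symm A * B) r) ∧
      (∀ P T : H →L[ℂ] H, IsOrthogonalProjector ℂ P → IsQuantumState ℂ T →
        ∃ r : ℝ, HasRealTrace ℂ (P * conjOp U T) r ∧ HasRealTrace ℂ (conjOp U.symm P * T) r)) ∧
    -- complex Hilbert spaces, `U` anti-unitary
    (∀ (H : Type*) [NormedAddCommGroup H] [InnerProductSpace ℂ H] [CompleteSpace H]
      (U : H ≃ₗᵢ⋆[ℂ] H),
      (∀ A B : H →L[ℂ] H, IsTraceClass ℂ A ∨ IsTraceClass ℂ B →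
        ∃ r : ℝ, HasRealTrace ℂ (A * conjOp U B) r ∧ HasRealTrace ℂ (conjOp U.symm A * B) r) ∧
      (∀ P T : H →L[ℂ] H, IsOrthogonalProjector ℂ P → IsQuantumState ℂ T →
        ∃ r : ℝ, HasRealTrace ℂ (P * conjOp U T) r ∧ HasRealTrace ℂ (conjOp U.symm P * T) r)) ∧
    -- quaternionic Hilbert spaces
    (∀ (H : Type*) [NormedAddCommGroup H] [QuaternionicInnerProductSpace H] [CompleteSpace H]
      (U : H ≃ₗᵢ[ℍᵐᵒᵖ] H),
      (∀ A B : H →L[ℍᵐᵒᵖ] H, IsTraceClass ℍ A ∨ IsTraceClass ℍ B →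
        ∃ r : ℝ, HasRealTrace ℍ (A * conjOp U B) r ∧ HasRealTrace ℍ (conjOp U.symm A * B) r) ∧
      (∀ P T : H →L[ℍᵐᵒᵖ] H, IsOrthogonalProjector ℍ P → IsQuantumState ℍ T →
        ∃ r : ℝ, HasRealTrace ℍ (P * conjOp U T) r ∧
          HasRealTrace ℍ (conjOp U.symm P * T) r)) := by
  refine ⟨fun H _ _ _ U => (realFrame H).exists_hasRealTrace_conjOp U (map_smul U),
    fun H _ _ _ U => ?_, fun H _ _ _ U => ?_, fun H _ _ _ U => ?_⟩
  · let := InnerProductSpace.complexToReal (G := H)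
    refine (complexFrame H).exists_hasRealTrace_conjOp U fun r x => ?_
    rw [← Complex.coe_smul, map_smul, Complex.coe_smul]
  · let := InnerProductSpace.complexToReal (G := H)
    refine (complexFrame H).exists_hasRealTrace_conjOp U fun r x => ?_
    rw [← Complex.coe_smul, map_smulₛₗ, Complex.conj_ofReal, Complex.coe_smul]
  · let := QuaternionicInnerProductSpace.toRealInnerProductSpace H
    exact (QuaternionicInnerProductSpace.quaternionFrame H).exists_hasRealTrace_conjOp U
      fun r x => map_smul U (op (algebraMap ℝ ℍ r)) x
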